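/- Let $k\ge 1$ and $m>1$ be integers. For $1\le i\le k$ let $R_i=(i^{\,k+1-i})$ be the rectangular partition with $k+1-i$ parts equal to $i$ (its largest hook length is $k$). For partitions $\lambda,\mu$ let $\lambda\cup\mu$ be the partition obtained by combining the parts of $\lambda$ and $\mu$ and placing them into non-increasing order, and write $\lambda\subseteq\mu$ for containment of Young diagrams. Let $Y^k_m$ be the set of all $k$-bounded partitions $\lambda$ (all parts at most $k$, the empty partition included) such that $\lambda\subseteq R_{i_1}\cup R_{i_2}\cup\dots\cup R_{i_{m-1}}$ for some $i_1,\dots,i_{m-1}\in\{1,\dots,k\}$, not necessarily distinct. Then $Y^k_m$ is finite and has exactly $m^k$ elements. -/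

import Mathlib

/-! Partitions are identified with their Young diagrams (`YoungDiagram`), so that containment
`λ ⊂ μ` of partitions is the order `≤` of `YoungDiagram`. -/

namespace KYoung

/-- The parts of a partition, as a multiset of (positive) row lengths. -/
def parts (μ : YoungDiagram) : Multiset ℕ := (μ.rowLens : Multiset ℕ)

/-- The partition whose parts are the members of `s`, put into non-increasing order. -/
def ofParts (s : Multiset ℕ) : YoungDiagram :=
  YoungDiagram.ofRowLens (s.sort (· ≥ ·)) (s.pairwise_sort (· ≥ ·)).sortedGE

/-- The `k`-rectangle `R_i = (i^(k+1-i))`, for `1 ≤ i ≤ k`: it has `k + 1 - i` parts, all equal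
to `i`, so that its largest hook length is `k`. -/
def rect (k i : ℕ) : YoungDiagram := ofParts (Multiset.replicate (k + 1 - i) i)

/-- The union (stack) `μ_1 ∪ ⋯ ∪ μ_r` of partitions: combine all their parts and put them into
non-increasing order. -/
def stack {r : ℕ} (μ : Fin r → YoungDiagram) : YoungDiagram := ofParts (∑ j, parts (μ j))

/-- A partition is `k`-bounded if all its parts are at most `k`. -/
def IsKBounded (k : ℕ) (μ : YoungDiagram) : Prop := ∀ p ∈ parts μ, p ≤ k

/-- The set `Y^k_m` of the `k`-bounded partitions that are contained in a stack
`R_{i_1} ∪ ⋯ ∪ R_{i_{m-1}}` of `m - 1` of the `k`-rectangles (repetitions allowed). -/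
def Y (k m : ℕ) : Set YoungDiagram :=
  {μ | IsKBounded k μ ∧
    ∃ i : Fin (m - 1) → ℕ, (∀ j, 1 ≤ i j ∧ i j ≤ k) ∧ μ ≤ stack (fun j => rect k (i j))}

end KYoung

namespace KYoung

/-! A `k`-bounded partition is its list of multiplicities, and its column lengths are the suffix
sums. A rectangle of height `h = k + 1 - i` meets column `v` iff `h ≤ k - v`, so containment in a
stack bounds each suffix sum by a sum of heights. `Feasible` chooses these heights from the tallest
down, carrying the row slack `e` still owed.

Let `N(j, q, e)` count the feasible lists of length `j`. Splitting on whether the first multiplicity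
is zero gives `N(j+1, q, e) = N(j, q, e) + N(j+1, q, e+1)` for `e ≤ j`. At `e = j+1` one tallest
rectangle can be traded for the slack: `N(j+1, q+1, j+1) = N(j+1, q, 0)`, and `N(j+1, 0, j+1) = 0`.
Hence `N(j, q, e) = q^e (q+1)^(j-e)`, which is `m^k` at `j = k`, `q = m - 1`, `e = 0`. -/

/-- `Feasible l q e`: if `l` lists the multiplicities of the parts `1, …, k`, then at most `q` of
the `k`-rectangles can be stacked so as to contain the partition and to have at least `e` more
rows than it. -/
def Feasible : List ℕ → ℕ → ℕ → Prop
  | [], _, e => e = 0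
  | a :: l, q, e => ∃ d ≤ q, Feasible l (q - d) (a + e - (l.length + 1) * d)

namespace Feasible

theorem anti {l : List ℕ} : ∀ {q e e' : ℕ}, e' ≤ e → Feasible l q e → Feasible l q e' := by
  induction l with
  | nil => intro q e e' h hf; simp only [Feasible] at *; omega
  | cons a l ih =>
    rintro q e e' h ⟨d, hd, hf⟩
    exact ⟨d, hd, ih (by omega) hf⟩

theorem mono {l : List ℕ} : ∀ {q q' e : ℕ}, q ≤ q' → Feasible l q e → Feasible l q' e := by
  induction l with
  | nil => intro q e e' h hf; exact hf
  | cons a l ih =>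
    rintro q q' e h ⟨d, hd, hf⟩
    exact ⟨d, hd.trans h, ih (by omega) hf⟩

/-- One more rectangle of the greatest height, `l.length`, supplies the extra rows. -/
theorem add_length {l : List ℕ} {q e : ℕ} (h : Feasible l q e) :
    Feasible l (q + 1) (e + l.length) := by
  cases l with
  | nil => simpa [Feasible] using h
  | cons a l =>
    obtain ⟨d, hd, hf⟩ := h
    refine ⟨d + 1, by omega, ?_⟩
    rwa [List.length_cons, mul_add, mul_one, ← add_assoc, Nat.add_sub_add_right,
      Nat.add_sub_add_right]

/-- No rectangle is taller than `l.length`, so discarding a tallest one used costs at most that much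
slack. -/
theorem of_add_length {l : List ℕ} : ∀ {q e : ℕ}, l ≠ [] →
    Feasible l (q + 1) (e + l.length) → Feasible l q e := by
  induction l with
  | nil => intro q e h; exact absurd rfl h
  | cons a l ih =>
    rintro q e - ⟨d, hd, hf⟩
    rcases d with _ | d
    · rcases l with _ | ⟨b, l⟩
      · simp [Feasible] at hf
      -- With no rectangle of full height in use, the one discarded is shorter, which leaves a spare
      -- row.
      · refine ⟨0, Nat.zero_le _, ?_⟩
        have : Feasible (b :: l) q (a + e + 1) := by
          refine ih (by simp) ?_
          convert hf using 1
          · omega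
          · simp only [List.length_cons]
            omega
        exact anti (by omega) this
    · refine ⟨d, by omega, ?_⟩
      rwa [List.length_cons, mul_add, mul_one, ← add_assoc, Nat.add_sub_add_right,
        Nat.add_sub_add_right] at hf

theorem eq_zero {l : List ℕ} : ∀ {e : ℕ}, Feasible l 0 e → e = 0 := by
  induction l with
  | nil => intro e h; exact h
  | cons a l ih =>
    rintro e ⟨d, hd, hf⟩
    obtain rfl : d = 0 := by omega
    have := ih hf
    omega

theorem cons_zero_iff {l : List ℕ} {q e : ℕ} (he : e ≤ l.length) :
    Feasible (0 :: l) q e ↔ Feasible l q e := by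
  refine ⟨?_, fun h => ⟨0, Nat.zero_le _, by simpa using h⟩⟩
  rintro ⟨d, hd, hf⟩
  rcases d with _ | d
  · simpa using hf
  -- A rectangle of height `l.length + 1` can be swapped for one of height `l.length`, which already
  -- covers `e`.
  · have := add_length hf
    exact mono (by omega) (anti (by omega) this)

theorem cons_succ_iff {l : List ℕ} {a q e : ℕ} :
    Feasible ((a + 1) :: l) q e ↔ Feasible (a :: l) q (e + 1) := by
  simp only [Feasible]
  rw [show a + 1 + e = a + (e + 1) by omega]

/-- `H` collects the heights of the rectangles; the recursion's `d` is the multiplicity in `H` of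
the greatest height. -/
theorem iff_exists_multiset {l : List ℕ} : ∀ {q e : ℕ}, Feasible l q e ↔
    ∃ H : Multiset ℕ, (∀ h ∈ H, 1 ≤ h ∧ h ≤ l.length) ∧ H.card ≤ q ∧ l.sum + e ≤ H.sum ∧
      ∀ v, (l.drop v).sum ≤ (H.filter (· ≤ l.length - v)).sum := by
  induction l with
  | nil =>
    intro q e
    constructor
    · rintro h
      exact ⟨0, by simp, by simp, by simpa [Feasible] using h, by simp⟩
    · rintro ⟨H, hH, -, h, -⟩
      have : H = 0 := Multiset.eq_zero_of_forall_notMem fun a ha => by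
        have := hH a ha
        simp only [List.length_nil] at this
        omega
      simpa [this, Feasible] using h
  | cons a l ih =>
    intro q e
    constructor
    · rintro ⟨d, hd, hf⟩
      obtain ⟨H, hH, hc, hs, hv⟩ := ih.1 hf
      have hle : ∀ h ∈ H + Multiset.replicate d (l.length + 1), 1 ≤ h ∧ h ≤ l.length + 1 := by
        intro h hh
        rcases Multiset.mem_add.1 hh with hh | hh
        · have := hH h hh
          omega
        · rw [Multiset.eq_of_mem_replicate hh]
          omega
      have hsum : (H + Multiset.replicate d (l.length + 1)).sum = H.sum + (l.length + 1) * d := by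
        simp [mul_comm]
      have hs' : a + l.sum + e ≤ H.sum + (l.length + 1) * d := by omega
      refine ⟨H + Multiset.replicate d (l.length + 1), hle, ?_, ?_, ?_⟩
      · simp only [Multiset.card_add, Multiset.card_replicate]
        omega
      · rw [hsum, List.sum_cons]
        exact hs'
      · rintro (_ | v)
        · rw [Multiset.filter_eq_self.2 (fun h hh => by simpa using (hle h hh).2), hsum]
          simp only [List.drop_zero, List.sum_cons]
          omega
        · simp only [List.drop_succ_cons, List.length_cons, Nat.add_sub_add_right,
            Multiset.filter_add, Multiset.sum_add]
          exact (hv v).trans (Nat.le_add_right _ _)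
    · rintro ⟨H, hH, hc, hs, hv⟩
      have hsplit : H = H.filter (· ≤ l.length) +
          Multiset.replicate (H.count (l.length + 1)) (l.length + 1) := by
        conv_lhs => rw [← Multiset.filter_add_not (· ≤ l.length) H]
        congr 1
        rw [← Multiset.filter_eq']
        refine Multiset.filter_congr fun h hh => ?_
        have := (hH h hh).2
        rw [List.length_cons] at this
        omega
      set H' := H.filter (· ≤ l.length) with hH'
      set d := H.count (l.length + 1)
      have hcard : H.card = H'.card + d := by
        conv_lhs => rw [hsplit]
        simp
      have hsum : H.sum = H'.sum + (l.length + 1) * d := by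
        conv_lhs => rw [hsplit]
        simp [mul_comm]
      -- Needed when the tallest rectangles alone cover `a + e`, so that the truncated slack is `0`.
      have h1 : l.sum ≤ H'.sum := by simpa using hv 1
      refine ⟨d, by omega, ih.2 ⟨H', ?_, by omega, ?_, fun v => ?_⟩⟩
      · intro h hh
        rw [hH', Multiset.mem_filter] at hh
        exact ⟨(hH h hh.1).1, hh.2⟩
      · rw [List.sum_cons] at hs
        omega
      · have := hv (v + 1)
        simp only [List.drop_succ_cons, List.length_cons, Nat.add_sub_add_right] at this
        rw [hH', Multiset.filter_filter]
        refine this.trans_eq ?_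
        congr 1
        exact Multiset.filter_congr fun h _ => by omega

end Feasible

/-! ### Counting feasible lists -/

/-- The lists of `j` multiplicities that are feasible with `q` rectangles and slack `e`. -/
def feasibleLists (j q e : ℕ) : Set (List ℕ) := {l | l.length = j ∧ Feasible l q e}

theorem feasibleLists_succ {j q e : ℕ} (he : e ≤ j) :
    feasibleLists (j + 1) q e = List.cons 0 '' feasibleLists j q e ∪
      List.modifyHead (· + 1) '' feasibleLists (j + 1) q (e + 1) := by
  ext l
  simp only [feasibleLists, Set.mem_union, Set.mem_image, Set.mem_ofPred_eq]
  constructor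
  · rintro ⟨hl, hf⟩
    rcases l with _ | ⟨_ | a, l⟩
    · simp at hl
    · have hl' : l.length = j := by simpa using hl
      exact Or.inl ⟨l, ⟨hl', (Feasible.cons_zero_iff (hl' ▸ he)).1 hf⟩, rfl⟩
    · exact Or.inr ⟨a :: l, ⟨by simpa using hl, Feasible.cons_succ_iff.1 hf⟩, rfl⟩
  · rintro (⟨l, ⟨hl, hf⟩, rfl⟩ | ⟨l, ⟨hl, hf⟩, rfl⟩)
    · exact ⟨by simpa using hl, (Feasible.cons_zero_iff (hl ▸ he)).2 hf⟩
    · rcases l with _ | ⟨a, l⟩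
      · simp at hl
      · exact ⟨by simpa using hl, Feasible.cons_succ_iff.2 hf⟩

theorem feasibleLists_length_zero {j : ℕ} : feasibleLists (j + 1) 0 (j + 1) = ∅ := by
  refine Set.eq_empty_of_forall_notMem fun l hl => ?_
  have := hl.2.eq_zero
  omega

theorem feasibleLists_length_succ {j q : ℕ} :
    feasibleLists (j + 1) (q + 1) (j + 1) = feasibleLists (j + 1) q 0 := by
  ext l
  refine and_congr_right fun hl => ⟨fun h => ?_, fun h => ?_⟩
  · refine Feasible.of_add_length (fun h0 => by simp [h0] at hl) ?_
    rwa [hl, zero_add]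
  · have := h.add_length
    rwa [hl, zero_add] at this

theorem modifyHead_succ_injective :
    Function.Injective (List.modifyHead (· + 1) : List ℕ → List ℕ) := by
  rintro (_ | ⟨a, l⟩) (_ | ⟨b, l'⟩) h <;> simp_all

theorem feasibleLists_succ_finite_ncard {j q e : ℕ} (he : e ≤ j)
    (h1 : (feasibleLists j q e).Finite) (h2 : (feasibleLists (j + 1) q (e + 1)).Finite) :
    (feasibleLists (j + 1) q e).Finite ∧ (feasibleLists (j + 1) q e).ncard =
      (feasibleLists j q e).ncard + (feasibleLists (j + 1) q (e + 1)).ncard := by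
  rw [feasibleLists_succ he]
  refine ⟨(h1.image _).union (h2.image _), ?_⟩
  rw [Set.ncard_union_eq _ (h1.image _) (h2.image _),
    Set.ncard_image_of_injective _ (List.cons_injective),
    Set.ncard_image_of_injective _ modifyHead_succ_injective]
  rw [Set.disjoint_left]
  rintro _ ⟨l, -, rfl⟩ ⟨l', -, h⟩
  rcases l' with _ | ⟨a, l'⟩ <;> simp at h

theorem feasibleLists_finite_ncard (j : ℕ) : ∀ q e : ℕ, e ≤ j → (feasibleLists j q e).Finite ∧
    (feasibleLists j q e).ncard = q ^ e * (q + 1) ^ (j - e) := by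
  induction j with
  | zero =>
    intro q e he
    obtain rfl : e = 0 := by omega
    have : feasibleLists 0 q 0 = {[]} := by
      ext l
      simp only [feasibleLists, List.length_eq_zero_iff, Set.mem_ofPred_eq,
        Set.mem_singleton_iff, and_iff_left_iff_imp]
      rintro rfl
      rfl
    simp [this]
  | succ j ihj =>
    -- For fixed `q`, the recurrence descends from the boundary value at `e = j + 1`.
    have step : ∀ q : ℕ, (feasibleLists (j + 1) q (j + 1)).Finite ∧
        (feasibleLists (j + 1) q (j + 1)).ncard = q ^ (j + 1) →
        ∀ e : ℕ, e ≤ j + 1 → (feasibleLists (j + 1) q e).Finite ∧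
        (feasibleLists (j + 1) q e).ncard = q ^ e * (q + 1) ^ (j + 1 - e) := by
      intro q htop e he
      induction he using Nat.decreasingInduction with
      | self => simpa using htop
      | of_succ e he ih =>
        have hej : e ≤ j := by omega
        obtain ⟨hfin, hcard⟩ := feasibleLists_succ_finite_ncard hej (ihj q e hej).1 ih.1
        refine ⟨hfin, ?_⟩
        rw [hcard, (ihj q e hej).2, ih.2, Nat.add_sub_add_right,
          show j + 1 - e = j - e + 1 by omega]
        ring
    intro q
    induction q with
    | zero => exact step 0 (by simp [feasibleLists_length_zero])
    | succ q ihq =>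
      refine step (q + 1) ?_
      rw [feasibleLists_length_succ]
      simpa using ihq 0 (Nat.zero_le _)

/-! ### Containment through column lengths -/

theorem exists_lt_getElem_iff_lt_countP {w : List ℕ} (hw : w.Pairwise (· ≥ ·)) (v : ℕ) :
    ∀ i, (∃ h : i < w.length, v < w[i]) ↔ i < w.countP (v < ·) := by
  induction w with
  | nil => simp
  | cons a w ih =>
    rw [List.pairwise_cons] at hw
    intro i
    by_cases hva : v < a
    · rcases i with _ | i
      · simp [hva]
      · simpa [hva] using ih hw.2 i
    · have h0 : ∀ b ∈ a :: w, ¬ v < b := by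
        intro b hb
        rcases List.mem_cons.1 hb with rfl | hb
        · exact hva
        · have := hw.1 b hb
          omega
      rw [List.countP_eq_zero.2 (by simpa using h0)]
      simp only [not_lt_zero, iff_false, not_exists]
      exact fun h => h0 _ (List.getElem_mem h)

theorem colLen_ofParts (s : Multiset ℕ) (v : ℕ) :
    (ofParts s).colLen v = (s.filter (v < ·)).card := by
  refine eq_of_forall_lt_iff fun i => ?_
  rw [← YoungDiagram.mem_iff_lt_colLen, ofParts, YoungDiagram.mem_ofRowLens,
    exists_lt_getElem_iff_lt_countP (s.pairwise_sort _), ← Multiset.countP_eq_card_filter]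
  conv_rhs => rw [← s.sort_eq (· ≥ ·)]
  rw [Multiset.coe_countP]

theorem ofParts_parts (μ : YoungDiagram) : ofParts (parts μ) = μ := by
  have h : (parts μ).sort (· ≥ ·) = μ.rowLens :=
    List.Perm.eq_of_pairwise' ((parts μ).pairwise_sort _) μ.rowLens_sorted.pairwise
      (Multiset.coe_eq_coe.1 ((parts μ).sort_eq _))
  conv_rhs => rw [← YoungDiagram.ofRowLens_to_rowLens_eq_self (μ := μ)]
  simp only [ofParts, h]

theorem card_filter_lt_parts (μ : YoungDiagram) (v : ℕ) :
    ((parts μ).filter (v < ·)).card = μ.colLen v := by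
  rw [← colLen_ofParts, ofParts_parts]

theorem le_iff_colLen_le {μ ν : YoungDiagram} : μ ≤ ν ↔ ∀ v, μ.colLen v ≤ ν.colLen v := by
  refine ⟨fun h v => ?_, fun h => ?_⟩
  · by_contra! hv
    exact lt_irrefl _ (YoungDiagram.mem_iff_lt_colLen.1 (h (YoungDiagram.mem_iff_lt_colLen.2 hv)))
  · rintro ⟨i, v⟩ hi
    exact YoungDiagram.mem_iff_lt_colLen.2 ((YoungDiagram.mem_iff_lt_colLen.1 hi).trans_le (h v))

theorem isKBounded_iff {k : ℕ} {μ : YoungDiagram} : IsKBounded k μ ↔ μ.colLen k = 0 := by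
  rw [← card_filter_lt_parts, Multiset.card_eq_zero, Multiset.filter_eq_nil]
  simp [IsKBounded]

theorem parts_ofParts_filter (s : Multiset ℕ) (v : ℕ) :
    ((parts (ofParts s)).filter (v < ·)).card = (s.filter (v < ·)).card := by
  rw [card_filter_lt_parts, colLen_ofParts]

theorem card_filter_finset_sum {ι : Type*} (t : Finset ι) (f : ι → Multiset ℕ) (v : ℕ) :
    ((∑ j ∈ t, f j).filter (v < ·)).card = ∑ j ∈ t, ((f j).filter (v < ·)).card := by
  classical
  induction t using Finset.induction_on with
  | empty => simp
  | insert a t ha ih => rw [Finset.sum_insert ha, Finset.sum_insert ha, Multiset.filter_add,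
      Multiset.card_add, ih]

theorem colLen_stack_rect (k : ℕ) {r : ℕ} (i : Fin r → ℕ) (v : ℕ) :
    (stack fun j => rect k (i j)).colLen v = ∑ j, if v < i j then k + 1 - i j else 0 := by
  rw [stack, colLen_ofParts, card_filter_finset_sum]
  refine Finset.sum_congr rfl fun j _ => ?_
  rw [rect, parts_ofParts_filter]
  split_ifs with h
  · rw [Multiset.filter_eq_self.2, Multiset.card_replicate]
    intro a ha
    rwa [Multiset.eq_of_mem_replicate ha]
  · rw [Multiset.filter_eq_nil.2, Multiset.card_zero]
    intro a ha
    rwa [Multiset.eq_of_mem_replicate ha]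

/-! ### Partitions as lists of multiplicities -/

/-- The parts of the partition in which the part `i + 1` has multiplicity `l[i]`. -/
def partsOfMult : List ℕ → Multiset ℕ
  | [] => 0
  | a :: l => Multiset.replicate a 1 + (partsOfMult l).map (· + 1)

theorem pos_of_mem_partsOfMult {l : List ℕ} : ∀ p ∈ partsOfMult l, 0 < p := by
  cases l with
  | nil => simp [partsOfMult]
  | cons a l =>
    intro p hp
    rcases Multiset.mem_add.1 hp with hp | hp
    · rw [Multiset.eq_of_mem_replicate hp]
      exact one_pos
    · obtain ⟨b, -, rfl⟩ := Multiset.mem_map.1 hp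
      exact Nat.succ_pos b

theorem card_filter_partsOfMult (l : List ℕ) :
    ∀ v, ((partsOfMult l).filter (v < ·)).card = (l.drop v).sum := by
  induction l with
  | nil => simp [partsOfMult]
  | cons a l ih =>
    rintro (_ | v)
    · rw [Multiset.filter_eq_self.2 pos_of_mem_partsOfMult]
      have := ih 0
      rw [Multiset.filter_eq_self.2 pos_of_mem_partsOfMult] at this
      simpa [partsOfMult] using this
    · rw [partsOfMult, Multiset.filter_add, Multiset.filter_map, Multiset.card_add,
        Multiset.card_map, Multiset.filter_eq_nil.2, Multiset.card_zero, zero_add,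
        List.drop_succ_cons, ← ih v]
      · congr 1
        exact Multiset.filter_congr fun b _ => by simp
      · intro b hb
        rw [Multiset.eq_of_mem_replicate hb]
        omega

theorem colLen_ofParts_partsOfMult (l : List ℕ) (v : ℕ) :
    (ofParts (partsOfMult l)).colLen v = (l.drop v).sum := by
  rw [colLen_ofParts, card_filter_partsOfMult]

theorem eq_of_sum_drop_eq {l : List ℕ} : ∀ {l' : List ℕ}, l.length = l'.length →
    (∀ v, (l.drop v).sum = (l'.drop v).sum) → l = l' := by
  induction l with
  | nil => intro l' h _; exact (List.length_eq_zero_iff.1 h.symm).symm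
  | cons a l ih =>
    rintro (_ | ⟨b, l'⟩) h hv
    · simp at h
    · obtain rfl := ih (by simpa using h) fun v => by simpa using hv (v + 1)
      have := hv 0
      simp only [List.drop_zero, List.sum_cons, Nat.add_right_cancel_iff] at this
      rw [this]

/-- The multiplicities are the successive differences of the column lengths. -/
theorem exists_sum_drop_eq {k : ℕ} : ∀ {c : ℕ → ℕ}, Antitone c → c k = 0 →
    ∃ l : List ℕ, l.length = k ∧ ∀ v, (l.drop v).sum = c v := by
  induction k with
  | zero =>
    intro c hc h0
    refine ⟨[], rfl, fun v => ?_⟩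
    have := hc (Nat.zero_le v)
    simp only [List.drop_nil, List.sum_nil]
    omega
  | succ k ih =>
    intro c hc h0
    obtain ⟨l, hl, hv⟩ := ih (c := fun v => c (v + 1)) (fun a b h => hc (by omega)) h0
    refine ⟨(c 0 - c 1) :: l, by simp [hl], ?_⟩
    rintro (_ | v)
    · have h1 := hv 0
      have h2 := hc (Nat.zero_le 1)
      simp only [List.drop_zero, zero_add] at h1
      simp only [List.drop_zero, List.sum_cons, h1]
      omega
    · simpa using hv v

/-! ### From feasible lists to stacks of rectangles -/

theorem sum_filter_map_univ {ι : Type*} [Fintype ι] (f : ι → ℕ) (p : ℕ → Prop) [DecidablePred p] :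
    (((Finset.univ : Finset ι).val.map f).filter p).sum = ∑ j, if p (f j) then f j else 0 := by
  rw [Multiset.filter_map, ← Finset.sum_filter]
  rfl

theorem feasible_iff_exists_rect {l : List ℕ} {q : ℕ} (hl : 0 < l.length) :
    Feasible l q 0 ↔ ∃ i : Fin q → ℕ, (∀ j, 1 ≤ i j ∧ i j ≤ l.length) ∧
      ∀ v, (l.drop v).sum ≤ ∑ j, if v < i j then l.length + 1 - i j else 0 := by
  rw [Feasible.iff_exists_multiset]
  constructor
  · rintro ⟨H, hH, hc, -, hv⟩
    -- Padding with height `1`, that is with copies of the widest rectangle, makes the number of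
    -- rectangles exactly `q`.
    obtain ⟨L, hL⟩ := Quot.exists_rep (H + Multiset.replicate (q - H.card) 1)
    have hLH : (L : Multiset ℕ) = H + Multiset.replicate (q - H.card) 1 := hL
    have hlen : L.length = q := by
      rw [← Multiset.coe_card, hLH, Multiset.card_add, Multiset.card_replicate]
      omega
    subst hlen
    have hmem : ∀ h ∈ L, 1 ≤ h ∧ h ≤ l.length := by
      intro h hh
      rw [← Multiset.mem_coe, hLH] at hh
      rcases Multiset.mem_add.1 hh with hh | hh
      · exact hH h hh
      · rw [Multiset.eq_of_mem_replicate hh]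
        omega
    refine ⟨fun j => l.length + 1 - L.get j, fun j => ?_, fun v => ?_⟩
    · have := hmem _ (L.get_mem j)
      dsimp only
      omega
    · rcases le_or_gt l.length v with hlv | hlv
      · simp [List.drop_eq_nil_of_le hlv]
      refine (hv v).trans ?_
      have h1 : (H.filter (· ≤ l.length - v)).sum ≤
          ((L : Multiset ℕ).filter (· ≤ l.length - v)).sum := by
        rw [hLH, Multiset.filter_add, Multiset.sum_add]
        exact Nat.le_add_right _ _
      refine h1.trans_eq ?_
      rw [← List.ofFn_get L, ← Fin.univ_val_map, sum_filter_map_univ, List.ofFn_get]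
      refine Finset.sum_congr rfl fun j _ => ?_
      have := hmem _ (L.get_mem j)
      dsimp only
      split_ifs <;> omega
  · rintro ⟨i, hi, hv⟩
    have hv' : ∀ v, (l.drop v).sum ≤ (((Finset.univ : Finset (Fin q)).val.map
        fun j => l.length + 1 - i j).filter (· ≤ l.length - v)).sum := by
      intro v
      rcases le_or_gt l.length v with hlv | hlv
      · simp [List.drop_eq_nil_of_le hlv]
      refine (hv v).trans_eq ?_
      rw [sum_filter_map_univ]
      refine Finset.sum_congr rfl fun j _ => ?_
      have := hi j
      split_ifs <;> omega
    refine ⟨_, ?_, by simp, ?_, hv'⟩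
    · intro h hh
      obtain ⟨j, -, rfl⟩ := Multiset.mem_map.1 hh
      have := hi j
      omega
    · refine (hv' 0).trans ?_
      obtain ⟨t, ht⟩ := Multiset.le_iff_exists_add.1 (Multiset.filter_le (· ≤ l.length - 0)
        ((Finset.univ : Finset (Fin q)).val.map fun j => l.length + 1 - i j))
      conv_rhs => rw [ht, Multiset.sum_add]
      exact Nat.le_add_right _ _

theorem Y_eq_image {k m : ℕ} (hk : 0 < k) :
    Y k m = (fun l => ofParts (partsOfMult l)) '' feasibleLists k (m - 1) 0 := by
  ext μ
  simp only [Y, feasibleLists, Set.mem_ofPred_eq, Set.mem_image, isKBounded_iff,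
    le_iff_colLen_le, colLen_stack_rect]
  constructor
  · rintro ⟨h0, h⟩
    obtain ⟨l, rfl, hv⟩ := exists_sum_drop_eq (fun a b hab => μ.colLen_anti a b hab) h0
    refine ⟨l, ⟨rfl, (feasible_iff_exists_rect hk).2 (by simpa only [hv] using h)⟩, ?_⟩
    refine le_antisymm (le_iff_colLen_le.2 fun v => ?_) (le_iff_colLen_le.2 fun v => ?_) <;>
      rw [colLen_ofParts_partsOfMult, hv]
  · rintro ⟨l, ⟨rfl, hf⟩, rfl⟩
    simp only [colLen_ofParts_partsOfMult]
    exact ⟨by simp, (feasible_iff_exists_rect hk).1 hf⟩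

end KYoung

theorem mainTheorem3 (k m : ℕ) (hk : 0 < k) (hm : 1 < m) :
    (KYoung.Y k m).Finite ∧ (KYoung.Y k m).ncard = m ^ k := by
  obtain ⟨hfin, hcard⟩ := KYoung.feasibleLists_finite_ncard k (m - 1) 0 (Nat.zero_le k)
  rw [KYoung.Y_eq_image hk]
  refine ⟨hfin.image _, ?_⟩
  rw [Set.InjOn.ncard_image, hcard]
  · simp [Nat.sub_add_cancel hm.le]
  · intro l hl l' hl' h
    refine KYoung.eq_of_sum_drop_eq (hl.1.trans hl'.1.symm) fun v => ?_
    rw [← KYoung.colLen_ofParts_partsOfMult, ← KYoung.colLen_ofParts_partsOfMult]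
    exact congrArg (fun ν => YoungDiagram.colLen ν v) h
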